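/- Let $\mathcal X$ be a topological space with its Borel $\sigma$-algebra (for instance a subset of $\mathbb R^p$), let $\nu$ be a measure on $\mathcal X$, and let $\rho_X$ be a probability measure on $\mathcal X$ that is absolutely continuous with respect to $\nu$ and whose density $p_X=d\rho_X/d\nu$ satisfies $\ell\le p_X\le u$ ($\nu$-almost everywhere), where $0<\ell\le u<\infty$. Let $\psi_1,\psi_2,\dots$ be continuous functions on $\mathcal X$ with $\sup_{j}\|\psi_j\|_\infty\le M<\infty$ that form a complete orthonormal basis of $L^2_\nu$. For $\omega>1/2$ and $1\le J\le\infty$ put $$K_J^\omega(x,y)=\sum_{1\le j\le J} j^{-2\omega}\psi_j(x)\psi_j(y),\qquad (T_{X,J}^\omega g)(x)=\int_{\mathcal X} g(\tau)\,K_J^\omega(\tau,x)\,d\rho_X(\tau)\quad (g\in L^2_{\rho_X}).$$ For a compact positive operator $T$, let $\lambda_1(T)\ge\lambda_2(T)\ge\dots\ge 0$ denote its eigenvalues in decreasing order, counted with multiplicity (and continued by $0$ if there are only finitely many). 1. Let $s>1$ and $T_X=T_{X,\infty}^{s}$, that is, the covariance operator with kernel $\sum_{j\ge1}j^{-2s}\psi_j(x)\psi_j(y)$.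 Then $T_X$ is a well-defined compact positive operator on $L^2_{\rho_X}$, and $\lambda_j(T_X)=\Theta(j^{-2s})$ as $j\to\infty$ (each side is $O$ of the other). 2. For every $\omega>1/2$ and every $1\le J\le\infty$, $T_{X,J}^\omega$ is a well-defined compact positive operator on $L^2_{\rho_X}$, and $$\ell\, j^{-2\omega}\le \lambda_j(T_{X,J}^\omega)\le u\, j^{-2\omega}\qquad\text{for all integers } j \text{ with } 1\le j\le J.$$ In particular the constants do not depend on $J$. -/

import Mathlib

open MeasureTheory Filter Asymptotics

/-- The feature distribution `ρ` is absolutely continuous with respect to `ν`, and its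
Radon-Nikodym derivative lies between `ℓ` and `u`. -/
structure HasDensityBetween {X : Type*} [MeasurableSpace X] (ρ ν : Measure X) (ℓ u : ℝ) :
    Prop where
  absolutelyContinuous : ρ ≪ ν
  bounds : ∀ᵐ x ∂ν, ENNReal.ofReal ℓ ≤ ρ.rnDeriv ν x ∧ ρ.rnDeriv ν x ≤ ENNReal.ofReal u

/-- The functions `ψ 1, ψ 2, …` are continuous, bounded by the common constant `M`, and their
classes form a complete orthonormal system of `L²(ν)`. -/
structure IsBoundedContinuousBasis {X : Type*} [TopologicalSpace X] [MeasurableSpace X]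
    (ν : Measure X) (M : ℝ) (ψ : ℕ+ → X → ℝ) : Prop where
  continuous : ∀ j, Continuous (ψ j)
  bounded : ∀ j x, |ψ j x| ≤ M
  basis : ∃ b : HilbertBasis ℕ+ ℝ (Lp ℝ 2 ν), ∀ j, b j =ᵐ[ν] ψ j

/-- The kernel `K_J^ω(x, y) = ∑_{1 ≤ j ≤ J} j^(-2ω) ψ_j(x) ψ_j(y)`, where `J` is a natural
number or `∞` (that is `⊤`). For bounded `ψ` and `ω > 1/2` the series converges absolutely. -/
noncomputable def sieveKernel {X : Type*} (ψ : ℕ+ → X → ℝ) (ω : ℝ) (J : ℕ∞) (x y : X) : ℝ :=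
  ∑' j : ℕ+, if ((j : ℕ) : ℕ∞) ≤ J then ((j : ℕ) : ℝ) ^ (-2 * ω) * ψ j x * ψ j y else 0

/-- `T` is the covariance operator of the kernel `K` with respect to `ρ`: the bounded operator
on `L²(ρ)` given by `(T g)(x) = ∫ g(τ) K(τ, x) dρ(τ)`, the integrand being integrable. -/
def IsCovarianceOperator {X : Type*} [MeasurableSpace X] (ρ : Measure X) (K : X → X → ℝ)
    (T : Lp ℝ 2 ρ →L[ℝ] Lp ℝ 2 ρ) : Prop :=
  ∀ g : Lp ℝ 2 ρ, (∀ x, Integrable (fun τ => g τ * K τ x) ρ) ∧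
    T g =ᵐ[ρ] fun x => ∫ τ, g τ * K τ x ∂ρ

/-- There is at most one covariance operator of a given kernel. -/
theorem IsCovarianceOperator.unique {X : Type*} [MeasurableSpace X] {ρ : Measure X}
    {K : X → X → ℝ} {T T' : Lp ℝ 2 ρ →L[ℝ] Lp ℝ 2 ρ} (h : IsCovarianceOperator ρ K T)
    (h' : IsCovarianceOperator ρ K T') : T = T' :=
  ContinuousLinearMap.ext fun g => Lp.ext ((h g).2.trans (h' g).2.symm)

/-- The `j`-th eigenvalue (`j ≥ 1`) of a compact positive operator, in decreasing order and
counted with multiplicity: the largest eigenvalue `μ` such that the eigenspaces of the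
eigenvalues `≥ μ` together have dimension at least `j` (and `0` if there is none). -/
noncomputable def orderedEigenvalue {H : Type*} [NormedAddCommGroup H] [InnerProductSpace ℝ H]
    (T : H →L[ℝ] H) (j : ℕ) : ℝ :=
  sSup {μ : ℝ | Module.End.HasEigenvalue (T : H →ₗ[ℝ] H) μ ∧
    (j : Cardinal) ≤ Module.rank ℝ
      (⨆ μ' : Set.Ici μ, Module.End.eigenspace (T : H →ₗ[ℝ] H) (μ' : ℝ) : Submodule ℝ H)}

/-! The density bounds make the identity a bounded bijection `A : L²(ν) → L²(ρ)`, and its adjoint,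
multiplication by the density, satisfies `ℓ‖g‖² ≤ ‖A* g‖² ≤ u‖g‖²`. With `b` the orthonormal basis
of `L²(ν)` and `a j` the (truncated) weights, the covariance operator is `A D A*`, where `D` is
diagonal in `b` with entries `a j`. Its quadratic form is therefore `∑ a i ⟪b i, A* g⟫²`.

Courant–Fischer finishes the proof (`orderedEigenvalue_le`, `le_orderedEigenvalue`). On the `g` with
`A* g` orthogonal to `b 1, …, b (j-1)` the form is at most `u (a j) ‖g‖²`. On the `j`-dimensional
space of `g` with `A* g` in the span of `b 1, …, b j` it is at least `ℓ (a j) ‖g‖²`. Only `a j`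
enters, so the constants are independent of `J`. The kernel integral is identified with this series
in `isCovarianceOperator_rankOneSeries`; bounded `ψ` and `2ω > 1` give absolute convergence. -/

open Module.End in
/-- The span of the eigenspaces of `T` for the eigenvalues in `S`. -/
noncomputable def eigenspaceSup {H : Type*} [NormedAddCommGroup H] [InnerProductSpace ℝ H]
    (T : H →L[ℝ] H) (S : Set ℝ) : Submodule ℝ H :=
  ⨆ μ : S, eigenspace (T : H →ₗ[ℝ] H) (μ : ℝ)

/-! ### Courant–Fischer bounds for compact symmetric operators -/

section MinMax

variable {H : Type*} [NormedAddCommGroup H] [InnerProductSpace ℝ H] {T : H →L[ℝ] H}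

open Module.End

/-- Dimension count: fewer than `j` linear conditions cannot be injective on `W`. The cardinal rank
allows `W` to be infinite-dimensional. -/
theorem exists_ne_zero_mem_of_natCast_le_rank {F : Type*} [AddCommGroup F] [Module ℝ F]
    [FiniteDimensional ℝ F] {W : Submodule ℝ H} {j : ℕ} (hW : (j : Cardinal) ≤ Module.rank ℝ W)
    (L : H →ₗ[ℝ] F) (hF : Module.finrank ℝ F < j) : ∃ g ∈ W, g ≠ 0 ∧ L g = 0 := by
  obtain ⟨f, hf⟩ := Module.le_rank_iff_exists_linearMap.mp hW
  have hker : LinearMap.ker (L ∘ₗ W.subtype ∘ₗ f) ≠ ⊥ :=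
    LinearMap.ker_ne_bot_of_finrank_lt (by simpa using hF)
  obtain ⟨x, hx, hx0⟩ := Submodule.exists_mem_ne_zero_of_ne_bot hker
  refine ⟨f x, (f x).2, ?_, by simpa using hx⟩
  simpa using (map_ne_zero_iff f hf).mpr hx0

theorem exists_eigenvector_decomposition {S : Set ℝ} {g : H} (hg : g ∈ eigenspaceSup T S) :
    ∃ f : S →₀ H, (∀ μ, T (f μ) = (μ : ℝ) • f μ) ∧ ∑ μ ∈ f.support, f μ = g := by
  obtain ⟨f, hf, hsum⟩ := (Submodule.mem_iSup_iff_exists_finsupp _ _).mp hg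
  exact ⟨f, fun μ => mem_eigenspace_iff.mp (hf μ), hsum⟩

theorem LinearMap.IsSymmetric.inner_eq_zero_of_eigenvectors (hT : (T : H →ₗ[ℝ] H).IsSymmetric)
    {μ μ' : ℝ} (hne : μ ≠ μ') {x y : H} (hx : T x = μ • x) (hy : T y = μ' • y) :
    inner ℝ x y = 0 := by
  have h := hT x y
  simp only [ContinuousLinearMap.coe_coe, hx, hy, inner_smul_left, inner_smul_right,
    RCLike.conj_to_real] at h
  have : (μ - μ') * inner ℝ x y = 0 := by linarith
  exact (mul_eq_zero.mp this).resolve_left (sub_ne_zero.mpr hne)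

/-- The quadratic form and the norm of a vector in a span of eigenspaces. -/
theorem exists_rayleigh_decomposition (hT : (T : H →ₗ[ℝ] H).IsSymmetric) {S : Set ℝ} {g : H}
    (hg : g ∈ eigenspaceSup T S) :
    ∃ f : S →₀ H, ‖g‖ ^ 2 = ∑ μ ∈ f.support, ‖f μ‖ ^ 2 ∧
      inner ℝ (T g) g = ∑ μ ∈ f.support, (μ : ℝ) * ‖f μ‖ ^ 2 := by
  classical
  obtain ⟨f, hf, rfl⟩ := exists_eigenvector_decomposition hg
  have horth : ∀ μ ν : S, inner ℝ (f μ) (f ν) = if μ = ν then ‖f μ‖ ^ 2 else 0 := by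
    intro μ ν
    split_ifs with h
    · rw [h, real_inner_self_eq_norm_sq]
    · exact hT.inner_eq_zero_of_eigenvectors (fun h' => h (Subtype.ext h')) (hf μ) (hf ν)
  refine ⟨f, ?_, ?_⟩
  · rw [← real_inner_self_eq_norm_sq]
    simp only [sum_inner, inner_sum, horth]
    refine Finset.sum_congr rfl fun μ hμ => ?_
    simp [Finset.sum_ite_eq, hμ, eq_comm]
  · simp only [map_sum, sum_inner, inner_sum, hf, inner_smul_left, horth, RCLike.conj_to_real]
    refine Finset.sum_congr rfl fun μ hμ => ?_
    simp only [mul_ite, mul_zero, eq_comm, Finset.sum_ite_eq, if_pos hμ]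

theorem inner_le_of_mem_eigenspaceSup (hT : (T : H →ₗ[ℝ] H).IsSymmetric) {S : Set ℝ} {c : ℝ}
    (hS : ∀ μ ∈ S, μ ≤ c) {g : H} (hg : g ∈ eigenspaceSup T S) :
    inner ℝ (T g) g ≤ c * ‖g‖ ^ 2 := by
  obtain ⟨f, h1, h2⟩ := exists_rayleigh_decomposition hT hg
  rw [h1, h2, Finset.mul_sum]
  exact Finset.sum_le_sum fun μ _ => mul_le_mul_of_nonneg_right (hS μ μ.2) (sq_nonneg _)

theorem le_inner_of_mem_eigenspaceSup (hT : (T : H →ₗ[ℝ] H).IsSymmetric) {S : Set ℝ} {c : ℝ}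
    (hS : ∀ μ ∈ S, c ≤ μ) {g : H} (hg : g ∈ eigenspaceSup T S) :
    c * ‖g‖ ^ 2 ≤ inner ℝ (T g) g := by
  obtain ⟨f, h1, h2⟩ := exists_rayleigh_decomposition hT hg
  rw [h1, h2, Finset.mul_sum]
  exact Finset.sum_le_sum fun μ _ => mul_le_mul_of_nonneg_right (hS μ μ.2) (sq_nonneg _)

theorem eigenspace_le_eigenspaceSup {S : Set ℝ} {μ : ℝ} (hμ : μ ∈ S) :
    eigenspace (T : H →ₗ[ℝ] H) μ ≤ eigenspaceSup T S :=
  le_iSup (fun μ : S => eigenspace (T : H →ₗ[ℝ] H) (μ : ℝ)) ⟨μ, hμ⟩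

theorem eigenspaceSup_isOrtho (hT : (T : H →ₗ[ℝ] H).IsSymmetric) {S S' : Set ℝ}
    (h : Disjoint S S') : eigenspaceSup T S ⟂ eigenspaceSup T S' := by
  unfold eigenspaceSup
  rw [Submodule.isOrtho_iSup_left]
  intro μ
  rw [Submodule.isOrtho_iSup_right]
  intro μ'
  rw [Submodule.isOrtho_iff_inner_eq]
  intro x hx y hy
  exact hT.inner_eq_zero_of_eigenvectors (fun e => Set.disjoint_left.mp h μ.2 (by rw [e]; exact μ'.2))
    (mem_eigenspace_iff.mp hx) (mem_eigenspace_iff.mp hy)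

/-- On the orthogonal complement of the eigenspaces for the eigenvalues `≥ c`, the quadratic form
of a compact symmetric operator is at most `c`. -/
theorem inner_le_of_mem_orthogonal_eigenspaceSup [CompleteSpace H] (hc : IsCompactOperator T)
    (hT : (T : H →ₗ[ℝ] H).IsSymmetric) {c : ℝ} {g : H}
    (hg : g ∈ (eigenspaceSup T (Set.Ici c))ᗮ) : inner ℝ (T g) g ≤ c * ‖g‖ ^ 2 := by
  -- Split `g` along the closed span of the eigenspaces below `c`. The remainder `r` is orthogonal
  -- to every eigenspace, so the spectral theorem gives `r = 0`.
  set K := (eigenspaceSup T (Set.Iio c)).topologicalClosure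
  have : CompleteSpace K := (Submodule.isClosed_topologicalClosure _).completeSpace_coe
  obtain ⟨k, hk, r, hr, rfl⟩ := K.exists_add_mem_mem_orthogonal g
  have hkort : k ∈ (eigenspaceSup T (Set.Ici c))ᗮ := by
    refine (Submodule.topologicalClosure_minimal _ ?_ (Submodule.isClosed_orthogonal _)) hk
    exact eigenspaceSup_isOrtho hT (Set.disjoint_left.mpr fun x (hx : x < c) (hx' : c ≤ x) => not_lt.mpr hx' hx)
  have hr1 : r ∈ (eigenspaceSup T (Set.Ici c))ᗮ := by
    simpa using Submodule.sub_mem _ hg hkort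
  have hr2 : r ∈ (eigenspaceSup T (Set.Iio c))ᗮ :=
    Submodule.orthogonal_le (Submodule.le_topologicalClosure _) hr
  have hr0 : r ∈ (⨆ μ, eigenspace (T : Module.End ℝ H) μ)ᗮ := by
    have hr3 := Submodule.mem_inf.mpr ⟨hr1, hr2⟩
    rw [Submodule.inf_orthogonal] at hr3
    refine Submodule.orthogonal_le ?_ hr3
    refine iSup_le fun μ => ?_
    rcases le_or_gt c μ with hμ | hμ
    · exact (eigenspace_le_eigenspaceSup (Set.mem_Ici.mpr hμ)).trans le_sup_left
    · exact (eigenspace_le_eigenspaceSup (Set.mem_Iio.mpr hμ)).trans le_sup_right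
  rw [ContinuousLinearMap.orthogonalComplement_iSup_eigenspaces_eq_bot hc hT,
    Submodule.mem_bot] at hr0
  rw [hr0, add_zero]
  have hclosed : IsClosed {x : H | inner ℝ (T x) x ≤ c * ‖x‖ ^ 2} :=
    isClosed_le (by fun_prop) (by fun_prop)
  exact closure_minimal (fun x hx => inner_le_of_mem_eigenspaceSup hT (fun μ hμ => le_of_lt hμ) hx)
    hclosed hk

/-- If the eigenspaces for eigenvalues `≥ μ` span dimension at least `j`, they meet `ker L` in some
`g ≠ 0`, and there `μ‖g‖² ≤ ⟪T g, g⟫ ≤ C‖g‖²`. The condition `0 ≤ C` covers the default `sSup ∅ =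
0`. -/
theorem orderedEigenvalue_le (hT : (T : H →ₗ[ℝ] H).IsSymmetric) {F : Type*} [AddCommGroup F]
    [Module ℝ F] [FiniteDimensional ℝ F] (L : H →ₗ[ℝ] F) {j : ℕ} (hF : Module.finrank ℝ F < j)
    {C : ℝ} (hC : 0 ≤ C) (h : ∀ g, L g = 0 → inner ℝ (T g) g ≤ C * ‖g‖ ^ 2) :
    orderedEigenvalue T j ≤ C := by
  refine Real.sSup_le ?_ hC
  rintro μ ⟨-, hμ⟩
  obtain ⟨g, hg, hg0, hLg⟩ := exists_ne_zero_mem_of_natCast_le_rank hμ L hF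
  have h1 := (le_inner_of_mem_eigenspaceSup hT (fun _ h => h) hg).trans (h g hLg)
  exact le_of_mul_le_mul_right h1 (by positivity)

theorem le_norm_of_hasEigenvalue {μ : ℝ} (h : HasEigenvalue (T : H →ₗ[ℝ] H) μ) : μ ≤ ‖T‖ := by
  obtain ⟨v, hv, hv0⟩ := h.exists_hasEigenvector
  have h1 := T.le_opNorm v
  rw [show T v = μ • v from mem_eigenspace_iff.mp hv, norm_smul] at h1
  exact (le_abs_self μ).trans (le_of_mul_le_mul_right h1 (norm_pos_iff.mpr hv0))

/-- If the eigenspaces of the eigenvalues `≥ c` together have dimension at least `j`, then this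
already holds for the eigenvalues `≥ μ` for some eigenvalue `μ ≥ c`. -/
theorem exists_hasEigenvalue_le_rank {c : ℝ} {j : ℕ} (hj : 1 ≤ j)
    (h : (j : Cardinal) ≤ Module.rank ℝ (eigenspaceSup T (Set.Ici c))) :
    ∃ μ, c ≤ μ ∧ HasEigenvalue (T : H →ₗ[ℝ] H) μ ∧
      (j : Cardinal) ≤ Module.rank ℝ (eigenspaceSup T (Set.Ici μ)) := by
  classical
  -- Finitely many eigenvalues occur in the decompositions of `j` independent vectors; the smallest
  -- of them is the required `μ`.
  obtain ⟨v, hv⟩ := Module.le_rank_iff.mp h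
  choose f hf hsum using fun i => exists_eigenvector_decomposition (v i).2
  let s : Finset (Set.Ici c) := Finset.univ.biUnion fun i => (f i).support
  have hs : s.Nonempty := by
    by_contra hs
    rw [Finset.not_nonempty_iff_eq_empty] at hs
    have hsupp : (f ⟨0, hj⟩).support = ∅ := Finset.subset_empty.mp
      (hs ▸ Finset.subset_biUnion_of_mem (fun i => (f i).support) (Finset.mem_univ _))
    have h0 : v ⟨0, hj⟩ = 0 := by
      apply Subtype.ext
      rw [← hsum, hsupp, Finset.sum_empty]
      rfl
    exact hv.ne_zero _ h0
  obtain ⟨m, hm, hmin⟩ := s.exists_min_image id hs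
  obtain ⟨i, -, hi⟩ := Finset.mem_biUnion.mp hm
  have hmem : ∀ i, (v i : H) ∈ eigenspaceSup T (Set.Ici (m : ℝ)) := by
    intro i
    rw [← hsum]
    refine Submodule.sum_mem _ fun μ hμ => ?_
    exact eigenspace_le_eigenspaceSup
      (hmin μ (Finset.mem_biUnion.mpr ⟨i, Finset.mem_univ _, hμ⟩)) (mem_eigenspace_iff.mpr (hf i μ))
  refine ⟨m, m.2, hasEigenvalue_of_hasEigenvector
    ⟨mem_eigenspace_iff.mpr (hf i m), Finsupp.mem_support_iff.mp hi⟩, ?_⟩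
  refine Module.le_rank_iff.mpr ⟨fun i => ⟨v i, hmem i⟩, ?_⟩
  refine LinearIndependent.of_comp (eigenspaceSup T (Set.Ici (m : ℝ))).subtype ?_
  exact hv.map' (Submodule.subtype _) (Submodule.ker_subtype _)

/-- For `c < C`, if the eigenspaces for eigenvalues `≥ c` spanned dimension less than `j`, some
nonzero `g ∈ W` would be orthogonal to them. Its form would then be at most `c‖g‖² < C‖g‖²`, a
contradiction. -/
theorem le_orderedEigenvalue [CompleteSpace H] (hc : IsCompactOperator T)
    (hT : (T : H →ₗ[ℝ] H).IsSymmetric) {W : Submodule ℝ H} {j : ℕ} (hj : 1 ≤ j)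
    (hW : (j : Cardinal) ≤ Module.rank ℝ W) {C : ℝ}
    (h : ∀ g ∈ W, C * ‖g‖ ^ 2 ≤ inner ℝ (T g) g) : C ≤ orderedEigenvalue T j := by
  refine le_of_forall_lt_imp_le_of_dense fun c hcC => ?_
  have hrank : (j : Cardinal) ≤ Module.rank ℝ (eigenspaceSup T (Set.Ici c)) := by
    by_contra hlt
    rw [not_le] at hlt
    have hfin : FiniteDimensional ℝ (eigenspaceSup T (Set.Ici c)) :=
      Module.rank_lt_aleph0_iff.mp (hlt.trans (Cardinal.natCast_lt_aleph0))
    obtain ⟨g, hg, hg0, hgL⟩ := exists_ne_zero_mem_of_natCast_le_rank hW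
      ((eigenspaceSup T (Set.Ici c)).orthogonalProjectionOnto : H →ₗ[ℝ] _)
      (by rw [← Module.finrank_eq_rank] at hlt; exact_mod_cast hlt)
    have hg' : g ∈ (eigenspaceSup T (Set.Ici c))ᗮ := by
      simpa using hgL
    have h1 := (h g hg).trans (inner_le_of_mem_orthogonal_eigenspaceSup hc hT hg')
    exact absurd (le_of_mul_le_mul_right h1 (by positivity)) (not_le.mpr hcC)
  obtain ⟨μ, hcμ, hμ, hμr⟩ := exists_hasEigenvalue_le_rank hj hrank
  exact hcμ.trans (le_csSup ⟨‖T‖, fun x hx => le_norm_of_hasEigenvalue hx.1⟩ ⟨hμ, hμr⟩)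

end MinMax

/-! ### Series of rank-one operators and their eigenvalues -/

section RankOneSeries

open InnerProductSpace

variable {G : Type*} [NormedAddCommGroup G] [InnerProductSpace ℝ G]

/-- The operator `g ↦ ∑ i, a i ⟪φ i, g⟫ φ i`. -/
noncomputable def rankOneSeries {ι : Type*} (a : ι → ℝ) (φ : ι → G) : G →L[ℝ] G :=
  ∑' i, a i • rankOne ℝ (φ i) (φ i)

variable {ι : Type*} {a : ι → ℝ} {φ : ι → G}

theorem hasSum_rankOneSeries [CompleteSpace G] (h : Summable fun i => |a i| * ‖φ i‖ ^ 2) :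
    HasSum (fun i => a i • rankOne ℝ (φ i) (φ i)) (rankOneSeries a φ) := by
  refine Summable.hasSum (Summable.of_norm ?_)
  refine h.congr fun i => ?_
  rw [norm_smul, norm_rankOne, Real.norm_eq_abs, sq]

theorem hasSum_rankOneSeries_apply [CompleteSpace G] (h : Summable fun i => |a i| * ‖φ i‖ ^ 2)
    (g : G) : HasSum (fun i => a i • inner ℝ (φ i) g • φ i) (rankOneSeries a φ g) := by
  simpa using (hasSum_rankOneSeries h).mapL (ContinuousLinearMap.apply ℝ G g)

theorem hasSum_inner_rankOneSeries [CompleteSpace G] (h : Summable fun i => |a i| * ‖φ i‖ ^ 2)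
    (g : G) :
    HasSum (fun i => a i * inner ℝ (φ i) g ^ 2) (inner ℝ (rankOneSeries a φ g) g) := by
  have := (hasSum_rankOneSeries_apply h g).mapL (innerSL ℝ g)
  simp only [innerSL_apply_apply, inner_smul_right] at this
  simpa only [sq, real_inner_comm g] using this

theorem isCompactOperator_rankOneSeries [CompleteSpace G]
    (h : Summable fun i => |a i| * ‖φ i‖ ^ 2) : IsCompactOperator (rankOneSeries a φ) := by
  refine isCompactOperator_of_tendsto (hasSum_rankOneSeries h) (Eventually.of_forall fun s => ?_)
  refine Submodule.sum_mem (compactOperator (RingHom.id ℝ) G G) fun i _ =>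
    Submodule.smul_mem _ _ ?_
  change IsCompactOperator (rankOne ℝ (φ i) (φ i))
  rw [rankOne_def']
  exact (isCompactOperator_of_locallyCompactSpace_dom (innerSL ℝ (φ i))).clm_comp
    (ContinuousLinearMap.toSpanSingleton ℝ (φ i))

theorem isPositive_rankOneSeries [CompleteSpace G] (ha : ∀ i, 0 ≤ a i)
    (h : Summable fun i => |a i| * ‖φ i‖ ^ 2) : (rankOneSeries a φ).IsPositive := by
  rw [ContinuousLinearMap.isPositive_iff]
  refine ⟨fun x y => ?_, fun g => ?_⟩
  · have h1 := (hasSum_rankOneSeries_apply h x).mapL (innerSL ℝ y)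
    have h2 := (hasSum_rankOneSeries_apply h y).mapL (innerSL ℝ x)
    simp only [innerSL_apply_apply, inner_smul_right] at h1 h2
    simp only [ContinuousLinearMap.coe_coe]
    rw [real_inner_comm]
    refine h1.unique ?_
    convert h2 using 2 with i
    rw [real_inner_comm (φ i) x, real_inner_comm (φ i) y]
    ring
  · exact (hasSum_inner_rankOneSeries h g).nonneg fun i => mul_nonneg (ha i) (sq_nonneg _)

variable {H : Type*} [NormedAddCommGroup H] [InnerProductSpace ℝ H]
  {a : ℕ+ → ℝ} {φ : ℕ+ → G} {B : G →L[ℝ] H} {b : HilbertBasis ℕ+ ℝ H}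

theorem HilbertBasis.hasSum_inner_sq {ι : Type*} (b : HilbertBasis ι ℝ H) (x : H) :
    HasSum (fun i => inner ℝ (b i) x ^ 2) (‖x‖ ^ 2) := by
  have := b.hasSum_inner_mul_inner x x
  rw [real_inner_self_eq_norm_sq] at this
  simpa only [sq, real_inner_comm x] using this

/-- If `φ` is the image of an orthonormal basis under the adjoint of an operator `B` with
`‖B g‖² ≤ u ‖g‖²`, the eigenvalues of `∑ i, a i ⟪φ i, ·⟫ φ i` are at most `u a i`. -/
theorem orderedEigenvalue_rankOneSeries_le [CompleteSpace G] (ha : ∀ i, 0 ≤ a i) (ha' : Antitone a)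
    (h : Summable fun i => |a i| * ‖φ i‖ ^ 2) (hφ : ∀ i g, inner ℝ (φ i) g = inner ℝ (b i) (B g))
    {u : ℝ} (hu : 0 ≤ u) (hB : ∀ g, ‖B g‖ ^ 2 ≤ u * ‖g‖ ^ 2) (j : ℕ+) :
    orderedEigenvalue (rankOneSeries a φ) j ≤ u * a j := by
  refine orderedEigenvalue_le (isPositive_rankOneSeries ha h).isSymmetric
    -- The `j - 1` conditions `⟪φ i, g⟫ = 0` for `i < j`; the surviving terms have `a i ≤ a j`.
    (LinearMap.pi fun i : Finset.Ico 1 j => (innerSL ℝ (φ i) : G →ₗ[ℝ] ℝ)) ?_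
    (mul_nonneg hu (ha j)) fun g hg => ?_
  · rw [Module.finrank_pi, Fintype.card_coe, PNat.card_Ico]
    exact Nat.sub_lt j.pos one_pos
  · have hzero : ∀ i < j, inner ℝ (φ i) g = 0 := fun i hi =>
      congrFun hg ⟨i, Finset.mem_Ico.mpr ⟨one_le, hi⟩⟩
    have h1 : inner ℝ (rankOneSeries a φ g) g ≤ a j * ‖B g‖ ^ 2 := by
      refine hasSum_le (fun i => ?_) (hasSum_inner_rankOneSeries h g)
        ((b.hasSum_inner_sq (B g)).mul_left (a j))
      rw [← hφ]
      rcases lt_or_ge i j with hi | hi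
      · simp [hzero i hi]
      · exact mul_le_mul_of_nonneg_right (ha' hi) (sq_nonneg _)
    calc _ ≤ a j * ‖B g‖ ^ 2 := h1
      _ ≤ a j * (u * ‖g‖ ^ 2) := mul_le_mul_of_nonneg_left (hB g) (ha j)
      _ = u * a j * ‖g‖ ^ 2 := by ring

/-- If `φ` is the image of an orthonormal basis under the adjoint of a surjective operator `B` with
`ℓ ‖g‖² ≤ ‖B g‖²`, the eigenvalues of `∑ i, a i ⟪φ i, ·⟫ φ i` are at least `ℓ a i`. -/
theorem le_orderedEigenvalue_rankOneSeries [CompleteSpace G] (ha : ∀ i, 0 ≤ a i)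
    (ha' : Antitone a) (h : Summable fun i => |a i| * ‖φ i‖ ^ 2)
    (hφ : ∀ i g, inner ℝ (φ i) g = inner ℝ (b i) (B g)) (hsurj : Function.Surjective B)
    {ℓ : ℝ} (hB : ∀ g, ℓ * ‖g‖ ^ 2 ≤ ‖B g‖ ^ 2) (j : ℕ+) :
    ℓ * a j ≤ orderedEigenvalue (rankOneSeries a φ) j := by
  -- The test space is spanned by preimages of `b 1, …, b j`. There `B g` has no components beyond
  -- `j`, and `a i ≥ a j` for the others.
  choose v hv using fun i : Finset.Icc 1 j => hsurj (b i)
  have hv_ind : LinearIndependent ℝ v := by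
    refine LinearIndependent.of_comp (B : G →ₗ[ℝ] H) ?_
    have : (B : G →ₗ[ℝ] H) ∘ v = b ∘ Subtype.val := funext hv
    rw [this]
    exact b.orthonormal.linearIndependent.comp _ Subtype.val_injective
  refine le_orderedEigenvalue (isCompactOperator_rankOneSeries h)
    (isPositive_rankOneSeries ha h).isSymmetric j.pos (W := Submodule.span ℝ (Set.range v)) ?_
    fun g hg => ?_
  · have : FiniteDimensional ℝ (Submodule.span ℝ (Set.range v)) :=
      FiniteDimensional.span_of_finite ℝ (Set.finite_range v)
    rw [← Module.finrank_eq_rank, finrank_span_eq_card hv_ind, Fintype.card_coe, PNat.card_Icc]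
    simp
  · have hzero : ∀ i, j < i → inner ℝ (b i) (B g) = 0 := by
      intro i hi
      induction hg using Submodule.span_induction with
      | mem x hx =>
        obtain ⟨k, rfl⟩ := hx
        rw [hv]
        exact b.orthonormal.2 (ne_of_gt ((Finset.mem_Icc.mp k.2).2.trans_lt hi))
      | zero => simp
      | add x y _ _ hx hy => rw [map_add, inner_add_right, hx, hy, add_zero]
      | smul c x _ hx => rw [map_smul, inner_smul_right, hx, mul_zero]
    have h1 : a j * ‖B g‖ ^ 2 ≤ inner ℝ (rankOneSeries a φ g) g := by
      refine hasSum_le (fun i => ?_) ((b.hasSum_inner_sq (B g)).mul_left (a j))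
        (hasSum_inner_rankOneSeries h g)
      rw [hφ]
      rcases le_or_gt i j with hi | hi
      · exact mul_le_mul_of_nonneg_right (ha' hi) (sq_nonneg _)
      · simp [hzero i hi]
    calc ℓ * a j * ‖g‖ ^ 2 = a j * (ℓ * ‖g‖ ^ 2) := by ring
      _ ≤ a j * ‖B g‖ ^ 2 := mul_le_mul_of_nonneg_left (hB g) (ha j)
      _ ≤ _ := h1

end RankOneSeries

/-! ### Comparison of `L²(ρ)` and `L²(ν)` -/

section Measures

variable {X : Type*} [MeasurableSpace X] {ρ ν : Measure X} {ℓ u : ℝ}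

/-- No σ-finiteness of `ν` is needed: without a Lebesgue decomposition `rnDeriv` defaults to `0`,
and the lower bound `ℓ > 0` forces `ν = 0`, hence `ρ = 0`. -/
theorem HasDensityBetween.withDensity_eq [IsProbabilityMeasure ρ] (hℓ : 0 < ℓ)
    (h : HasDensityBetween ρ ν ℓ u) : ν.withDensity (ρ.rnDeriv ν) = ρ := by
  have hleb : ρ.HaveLebesgueDecomposition ν := by
    by_contra hn
    have hb := h.bounds
    rw [Measure.rnDeriv_of_not_haveLebesgueDecomposition hn] at hb
    have hν : ν = 0 := by
      rw [← ae_eq_bot, ← empty_mem_iff_bot]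
      filter_upwards [hb] with x hx
      exact absurd hx.1 (by simpa using hℓ)
    have hρ0 : ρ = 0 := Measure.absolutelyContinuous_zero_iff.mp (hν ▸ h.absolutelyContinuous)
    exact IsProbabilityMeasure.ne_zero ρ hρ0
  exact Measure.withDensity_rnDeriv_eq ρ ν h.absolutelyContinuous

theorem HasDensityBetween.le_smul [IsProbabilityMeasure ρ] (hℓ : 0 < ℓ)
    (h : HasDensityBetween ρ ν ℓ u) : ρ ≤ ENNReal.ofReal u • ν := by
  conv_lhs => rw [← h.withDensity_eq hℓ]
  rw [← withDensity_const]
  exact withDensity_mono (h.bounds.mono fun x hx => hx.2)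

theorem HasDensityBetween.le_smul_inv [IsProbabilityMeasure ρ] (hℓ : 0 < ℓ)
    (h : HasDensityBetween ρ ν ℓ u) : ν ≤ ENNReal.ofReal ℓ⁻¹ • ρ := by
  have h1 : ENNReal.ofReal ℓ • ν ≤ ρ := by
    conv_rhs => rw [← h.withDensity_eq hℓ]
    rw [← withDensity_const]
    exact withDensity_mono (h.bounds.mono fun x hx => hx.1)
  calc ν = ENNReal.ofReal ℓ⁻¹ • ENNReal.ofReal ℓ • ν := by
        rw [smul_smul, ← ENNReal.ofReal_mul (by positivity), inv_mul_cancel₀ hℓ.ne',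
          ENNReal.ofReal_one, one_smul]
    _ ≤ _ := by gcongr

theorem norm_LpToLpOfMeasureLeSMul_two_le {c : ℝ} (hc : 0 ≤ c) (h : ρ ≤ ENNReal.ofReal c • ν) :
    ‖(Lp.LpToLpOfMeasureLeSMul ENNReal.ofReal_ne_top h : Lp ℝ 2 ν →L[ℝ] Lp ℝ 2 ρ)‖ ≤ √c := by
  refine (Lp.norm_LpToLpOfMeasureLeSMul_le _ h).trans_eq ?_
  rw [ENNReal.toReal_ofReal hc, Real.sqrt_eq_rpow]
  simp

/-- The two inclusions are mutually inverse, hence so are their adjoints. -/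
theorem adjoint_LpToLpOfMeasureLeSMul_comp {c c' : ℝ} (h : ρ ≤ ENNReal.ofReal c • ν)
    (h' : ν ≤ ENNReal.ofReal c' • ρ) (g : Lp ℝ 2 ρ) :
    (Lp.LpToLpOfMeasureLeSMul ENNReal.ofReal_ne_top h' : Lp ℝ 2 ρ →L[ℝ] Lp ℝ 2 ν).adjoint
      ((Lp.LpToLpOfMeasureLeSMul ENNReal.ofReal_ne_top h :
        Lp ℝ 2 ν →L[ℝ] Lp ℝ 2 ρ).adjoint g) = g := by
  rw [← ContinuousLinearMap.comp_apply, ← ContinuousLinearMap.adjoint_comp]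
  have : (Lp.LpToLpOfMeasureLeSMul ENNReal.ofReal_ne_top h : Lp ℝ 2 ν →L[ℝ] Lp ℝ 2 ρ) ∘L
      Lp.LpToLpOfMeasureLeSMul ENNReal.ofReal_ne_top h' = ContinuousLinearMap.id ℝ _ := by
    ext1 f
    apply Lp.ext
    rw [ContinuousLinearMap.comp_apply]
    exact (Lp.coeFn_LpToLpOfMeasureLeSMul _ h _).trans
      ((Measure.absolutelyContinuous_of_le_smul h).ae_eq (Lp.coeFn_LpToLpOfMeasureLeSMul _ h' f))
  rw [this, ContinuousLinearMap.adjoint_id]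
  rfl

end Measures

/-! ### The sieve kernel and its covariance operator -/

section Sieve

/-- The weight `j^(-2ω)` of `ψ j` in the kernel, cut off at `J`. -/
noncomputable def sieveWeight (ω : ℝ) (J : ℕ∞) (j : ℕ+) : ℝ :=
  if ((j : ℕ) : ℕ∞) ≤ J then ((j : ℕ) : ℝ) ^ (-2 * ω) else 0

theorem sieveWeight_nonneg (ω : ℝ) (J : ℕ∞) (j : ℕ+) : 0 ≤ sieveWeight ω J j := by
  unfold sieveWeight
  split_ifs <;> positivity

theorem sieveWeight_of_le (ω : ℝ) {J : ℕ∞} {j : ℕ+} (h : ((j : ℕ) : ℕ∞) ≤ J) :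
    sieveWeight ω J j = ((j : ℕ) : ℝ) ^ (-2 * ω) := if_pos h

theorem sieveWeight_antitone {ω : ℝ} (hω : 0 ≤ ω) (J : ℕ∞) : Antitone (sieveWeight ω J) := by
  intro i j hij
  have hij' : (i : ℕ) ≤ j := hij
  by_cases hj : ((j : ℕ) : ℕ∞) ≤ J
  · rw [sieveWeight_of_le ω hj, sieveWeight_of_le ω (le_trans (by exact_mod_cast hij') hj)]
    exact Real.rpow_le_rpow_of_nonpos (by exact_mod_cast i.pos) (by exact_mod_cast hij')
      (by linarith)
  · rw [sieveWeight, if_neg hj]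
    exact sieveWeight_nonneg ω J i

theorem summable_sieveWeight {ω : ℝ} (hω : 1 / 2 < ω) (J : ℕ∞) : Summable (sieveWeight ω J) := by
  have h : Summable fun j : ℕ+ => ((j : ℕ) : ℝ) ^ (-2 * ω) :=
    (Real.summable_nat_rpow.mpr (by linarith)).comp_injective PNat.coe_injective
  refine Summable.of_nonneg_of_le (sieveWeight_nonneg ω J) (fun j => ?_) h
  unfold sieveWeight
  split_ifs
  · exact le_rfl
  · positivity

theorem sieveKernel_eq {X : Type*} [TopologicalSpace X] [MeasurableSpace X] (ψ : ℕ+ → X → ℝ) (ω : ℝ) (J : ℕ∞) (x y : X) :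
    sieveKernel ψ ω J x y = ∑' j, sieveWeight ω J j * ψ j x * ψ j y := by
  refine tsum_congr fun j => ?_
  unfold sieveWeight
  split_ifs <;> simp

variable {X : Type*} [TopologicalSpace X] [MeasurableSpace X] [BorelSpace X] {ν ρ : Measure X} {M : ℝ} {ψ : ℕ+ → X → ℝ}

/-- The terms are dominated by the summable `sieveWeight ω J j * (M * M)`, so sum and integral
commute at every `x`. -/
theorem isCovarianceOperator_rankOneSeries [IsProbabilityMeasure ρ]
    (hcont : ∀ j, Continuous (ψ j)) (hbdd : ∀ j x, |ψ j x| ≤ M) {ω : ℝ} (hω : 1 / 2 < ω) (J : ℕ∞)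
    {φ : ℕ+ → Lp ℝ 2 ρ} (hφ : ∀ j, φ j =ᵐ[ρ] ψ j)
    (hsum : Summable fun j => |sieveWeight ω J j| * ‖φ j‖ ^ 2) :
    IsCovarianceOperator ρ (sieveKernel ψ ω J) (rankOneSeries (sieveWeight ω J) φ) := by
  intro g
  have hg : Integrable g ρ := (Lp.memLp g).integrable (by norm_num)
  have ha := sieveWeight_nonneg ω J
  have hterm : ∀ x j τ, ‖sieveWeight ω J j * ψ j τ * ψ j x‖ ≤ sieveWeight ω J j * (M * M) := by
    intro x j τ
    rw [norm_mul, norm_mul, Real.norm_eq_abs, Real.norm_eq_abs, Real.norm_eq_abs,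
      abs_of_nonneg (ha j), mul_assoc]
    have hM : 0 ≤ M := (abs_nonneg _).trans (hbdd j x)
    have := hbdd j τ
    have := hbdd j x
    gcongr
    exact ha j
  have hsM : Summable fun j => sieveWeight ω J j * (M * M) :=
    (summable_sieveWeight hω J).mul_right _
  have hmeas : ∀ j, AEStronglyMeasurable (ψ j) ρ := fun j =>
    (hcont j).measurable.aestronglyMeasurable
  have hFint : ∀ x j, Integrable (fun τ => g τ * (sieveWeight ω J j * ψ j τ * ψ j x)) ρ :=
    fun x j => hg.mul_bdd (((hmeas j).const_mul _).mul_const _)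
      (Eventually.of_forall (hterm x j))
  have hintegral : ∀ x, HasSum
      (fun j => ∫ τ, g τ * (sieveWeight ω J j * ψ j τ * ψ j x) ∂ρ)
      (∫ τ, g τ * sieveKernel ψ ω J τ x ∂ρ) := by
    intro x
    have h1 := hasSum_integral_of_summable_integral_norm (hFint x) ?_
    · simpa only [tsum_mul_left, ← sieveKernel_eq] using h1
    · refine Summable.of_nonneg_of_le (fun j => integral_nonneg fun _ => norm_nonneg _)
        (fun j => ?_) (hsM.mul_left (∫ τ, ‖g τ‖ ∂ρ))
      rw [← integral_mul_const]
      refine integral_mono (hFint x j).norm (hg.norm.mul_const _) fun τ => ?_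
      simp only [norm_mul (g τ)]
      exact mul_le_mul_of_nonneg_left (hterm x j τ) (norm_nonneg _)
  refine ⟨fun x => ?_, ?_⟩
  · refine hg.mul_bdd (c := ∑' j, sieveWeight ω J j * (M * M)) ?_
      (Eventually.of_forall fun τ => ?_)
    · simp only [sieveKernel_eq]
      exact (Measurable.tsum fun j =>
        ((hcont j).measurable.const_mul _).mul_const _).aestronglyMeasurable
    · rw [sieveKernel_eq]
      exact tsum_of_norm_bounded hsM.hasSum fun j => hterm x j τ
  · have hseries := hasSum_rankOneSeries_apply hsum g
    have hnorm : Summable fun j => ‖sieveWeight ω J j • inner ℝ (φ j) g • φ j‖ := by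
      refine Summable.of_nonneg_of_le (fun _ => norm_nonneg _) (fun j => ?_) (hsum.mul_right ‖g‖)
      rw [norm_smul, norm_smul, Real.norm_eq_abs, Real.norm_eq_abs, mul_assoc]
      have := abs_real_inner_le_norm (φ j) g
      calc _ ≤ |sieveWeight ω J j| * (‖φ j‖ * ‖g‖ * ‖φ j‖) := by gcongr
        _ = _ := by ring
    -- Summable norms upgrade convergence in `L²(ρ)` to pointwise convergence almost everywhere,
    -- which permits comparison with the integral.
    have hae := Lp.hasSum_coeFn_tsum (f := fun j => sieveWeight ω J j • inner ℝ (φ j) g • φ j)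
      (tsum_enorm_ne_top_iff_summable_norm.mpr hnorm)
    rw [hseries.tsum_eq] at hae
    have hinner : ∀ j, inner ℝ (φ j) g = ∫ τ, g τ * ψ j τ ∂ρ := by
      intro j
      rw [L2.inner_def]
      refine integral_congr_ae ?_
      filter_upwards [hφ j] with τ hτ
      rw [← hτ]
      rfl
    have hcoe : ∀ᵐ x ∂ρ, ∀ j, (sieveWeight ω J j • inner ℝ (φ j) g • φ j : Lp ℝ 2 ρ) x =
        sieveWeight ω J j * (inner ℝ (φ j) g * ψ j x) := by
      rw [ae_all_iff]
      intro j
      filter_upwards [Lp.coeFn_smul (sieveWeight ω J j) (inner ℝ (φ j) g • φ j),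
        Lp.coeFn_smul (inner ℝ (φ j) g) (φ j), hφ j] with x h1 h2 h3
      rw [h1, Pi.smul_apply, h2, Pi.smul_apply, h3, smul_eq_mul, smul_eq_mul]
    filter_upwards [hae, hcoe] with x hx hcx
    rw [← hx.tsum_eq, ← (hintegral x).tsum_eq]
    refine tsum_congr fun j => ?_
    rw [hcx, hinner, ← integral_mul_const, ← integral_const_mul]
    exact integral_congr_ae (Eventually.of_forall fun τ => by ring)

theorem exists_isCovarianceOperator_eigenvalue_bounds [IsProbabilityMeasure ρ] {ℓ u : ℝ}
    (hℓ : 0 < ℓ) (hℓu : ℓ ≤ u) (hρ : HasDensityBetween ρ ν ℓ u)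
    (hψ : IsBoundedContinuousBasis ν M ψ) {ω : ℝ} (hω : 1 / 2 < ω) (J : ℕ∞) :
    ∃ T : Lp ℝ 2 ρ →L[ℝ] Lp ℝ 2 ρ,
      IsCovarianceOperator ρ (sieveKernel ψ ω J) T ∧ IsCompactOperator T ∧ T.IsPositive ∧
        ∀ j : ℕ, 1 ≤ j → (j : ℕ∞) ≤ J →
          ℓ * (j : ℝ) ^ (-2 * ω) ≤ orderedEigenvalue T j ∧
            orderedEigenvalue T j ≤ u * (j : ℝ) ^ (-2 * ω) := by
  obtain ⟨b, hb⟩ := hψ.basis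
  have hu : 0 ≤ u := hℓ.le.trans hℓu
  have hle := hρ.le_smul hℓ
  have hle' := hρ.le_smul_inv hℓ
  let A : Lp ℝ 2 ν →L[ℝ] Lp ℝ 2 ρ := Lp.LpToLpOfMeasureLeSMul ENNReal.ofReal_ne_top hle
  let A' : Lp ℝ 2 ρ →L[ℝ] Lp ℝ 2 ν := Lp.LpToLpOfMeasureLeSMul ENNReal.ofReal_ne_top hle'
  have hA : ‖A‖ ≤ √u := norm_LpToLpOfMeasureLeSMul_two_le hu hle
  have hA' : ‖A'‖ ≤ √ℓ⁻¹ := norm_LpToLpOfMeasureLeSMul_two_le (by positivity) hle'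
  have hbound : ∀ g, ‖A.adjoint g‖ ^ 2 ≤ u * ‖g‖ ^ 2 := by
    intro g
    have h1 : ‖A.adjoint g‖ ≤ √u * ‖g‖ := by
      refine A.adjoint.le_of_opNorm_le ?_ g
      rwa [LinearIsometryEquiv.norm_map]
    calc _ ≤ (√u * ‖g‖) ^ 2 := by gcongr
      _ = _ := by rw [mul_pow, Real.sq_sqrt hu]
  have hbound' : ∀ g, ℓ * ‖g‖ ^ 2 ≤ ‖A.adjoint g‖ ^ 2 := by
    intro g
    have h1 : ‖g‖ ≤ √ℓ⁻¹ * ‖A.adjoint g‖ := by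
      conv_lhs => rw [← adjoint_LpToLpOfMeasureLeSMul_comp hle hle' g]
      refine A'.adjoint.le_of_opNorm_le ?_ _
      rwa [LinearIsometryEquiv.norm_map]
    calc _ ≤ ℓ * (√ℓ⁻¹ * ‖A.adjoint g‖) ^ 2 := by gcongr
      _ = _ := by
        rw [mul_pow, Real.sq_sqrt (by positivity), ← mul_assoc, mul_inv_cancel₀ hℓ.ne', one_mul]
  have hsurj : Function.Surjective A.adjoint := fun h =>
    ⟨A'.adjoint h, adjoint_LpToLpOfMeasureLeSMul_comp hle' hle h⟩
  have hφ : ∀ j, A (b j) =ᵐ[ρ] ψ j := fun j =>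
    (Lp.coeFn_LpToLpOfMeasureLeSMul _ hle _).trans (hρ.absolutelyContinuous.ae_eq (hb j))
  have hφb : ∀ j g, inner ℝ (A (b j)) g = inner ℝ (b j) (A.adjoint g) := fun j g =>
    (A.adjoint_inner_right _ _).symm
  have ha := sieveWeight_nonneg ω J
  have hanti := sieveWeight_antitone (by linarith : 0 ≤ ω) J
  have hsum : Summable fun j => |sieveWeight ω J j| * ‖A (b j)‖ ^ 2 := by
    refine Summable.of_nonneg_of_le (fun _ => by positivity) (fun j => ?_)
      ((summable_sieveWeight hω J).mul_right (‖A‖ ^ 2))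
    rw [abs_of_nonneg (ha j)]
    have h1 : ‖A (b j)‖ ≤ ‖A‖ := by
      simpa [b.orthonormal.1 j] using A.le_opNorm (b j)
    have := ha j
    gcongr
  refine ⟨rankOneSeries (sieveWeight ω J) fun j => A (b j),
    isCovarianceOperator_rankOneSeries hψ.continuous hψ.bounded hω J hφ hsum,
    isCompactOperator_rankOneSeries hsum, isPositive_rankOneSeries ha hsum, fun j hj hjJ => ?_⟩
  lift j to ℕ+ using hj
  rw [← sieveWeight_of_le ω hjJ]
  exact ⟨le_orderedEigenvalue_rankOneSeries ha hanti hsum hφb hsurj hbound' j,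
    orderedEigenvalue_rankOneSeries_le ha hanti hsum hφb hu hbound j⟩

end Sieve

theorem lemma6p2 {X : Type*} [TopologicalSpace X] [MeasurableSpace X] [BorelSpace X]
    (ν ρ : Measure X) [IsProbabilityMeasure ρ] (ℓ u M s : ℝ) (ψ : ℕ+ → X → ℝ)
    (hℓ : 0 < ℓ) (hℓu : ℓ ≤ u) (hs : 1 < s)
    (hρ : HasDensityBetween ρ ν ℓ u) (hψ : IsBoundedContinuousBasis ν M ψ) :
    (∃ T : Lp ℝ 2 ρ →L[ℝ] Lp ℝ 2 ρ,
      IsCovarianceOperator ρ (sieveKernel ψ s ⊤) T ∧ IsCompactOperator T ∧ T.IsPositive ∧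
        (fun j : ℕ => orderedEigenvalue T j) =Θ[atTop] (fun j : ℕ => (j : ℝ) ^ (-2 * s))) ∧
    (∀ ω : ℝ, 1 / 2 < ω → ∀ J : ℕ∞, 1 ≤ J →
      ∃ T : Lp ℝ 2 ρ →L[ℝ] Lp ℝ 2 ρ,
        IsCovarianceOperator ρ (sieveKernel ψ ω J) T ∧ IsCompactOperator T ∧ T.IsPositive ∧
          ∀ j : ℕ, 1 ≤ j → (j : ℕ∞) ≤ J →
            ℓ * (j : ℝ) ^ (-2 * ω) ≤ orderedEigenvalue T j ∧
              orderedEigenvalue T j ≤ u * (j : ℝ) ^ (-2 * ω)) := by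
  refine ⟨?_, fun ω hω J _ => exists_isCovarianceOperator_eigenvalue_bounds hℓ hℓu hρ hψ hω J⟩
  obtain ⟨T, hT, hc, hpos, hbounds⟩ := exists_isCovarianceOperator_eigenvalue_bounds
    hℓ hℓu hρ hψ (by linarith : 1 / 2 < s) ⊤
  -- The two-sided bounds with `J = ⊤` give the constants `u` and `ℓ⁻¹`. The case `j = 0` lies
  -- outside them, hence the restriction to `j ≥ 1`.
  refine ⟨T, hT, hc, hpos, IsBigO.of_bound u ?_, IsBigO.of_bound ℓ⁻¹ ?_⟩
  · filter_upwards [eventually_ge_atTop 1] with j hj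
    obtain ⟨h1, h2⟩ := hbounds j hj le_top
    have hj0 : (0 : ℝ) ≤ (j : ℝ) ^ (-2 * s) := by positivity
    rwa [Real.norm_of_nonneg hj0, Real.norm_of_nonneg ((by positivity : (0 : ℝ) ≤ _).trans h1)]
  · filter_upwards [eventually_ge_atTop 1] with j hj
    obtain ⟨h1, h2⟩ := hbounds j hj le_top
    have hj0 : (0 : ℝ) ≤ (j : ℝ) ^ (-2 * s) := by positivity
    rw [Real.norm_of_nonneg hj0, Real.norm_of_nonneg ((by positivity : (0 : ℝ) ≤ _).trans h1)]
    rwa [inv_mul_eq_div, le_div_iff₀ hℓ, mul_comm]
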